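/- Let $X$ be an infinite-dimensional (real or complex) Banach space and let $(x_i,f_i)_{i=1}^\infty\subset X\times X^*$ be a Schauder frame for $X$, i.e. $v=\sum_{i=1}^\infty f_i(v)x_i$ in norm for all $v\in X$. Assume that the frame is shrinking: with $T_n(v)=\sum_{i\ge n}f_i(v)x_i$ one has $\|x^*\circ T_n\|\to 0$ for all $x^*\in X^*$. Write $S_{X^*}$ for the unit sphere of $X^*$ and $[\mathbb N]^\omega$ for the set of strictly increasing sequences of natural numbers, and let $A\subseteq(\mathbb N\times S_{X^*})^\omega$. For $\varepsilon>0$ let $A_\varepsilon$ be the set of all $(\ell_i,y_i^*)_{i=1}^\infty\in(\mathbb N\times S_{X^*})^\omega$ for which there is $(k_i,x_i^*)_{i=1}^\infty\in A$ with $k_i\le \ell_i$ and $\|x_i^*-y_i^*\|<\varepsilon 2^{-i}$ for all $i$, and let $\overline{A}_\varepsilon$ be the closure of $A_\varepsilon$ in $(\mathbb N\times S_{X^*})^\omega$ (product topology, $\mathbb N$ discrete, $S_{X^*}$ with the norm topology). In the $(A,\varepsilon)$-game, on the $n$-th move ($n=1,2,\dots$) player $S$ picks $k_n\in\mathbb N$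 and a $w^*$-closed subspace $Z_n\subseteq X^*$ of finite codimension, and player $P$ responds with $x_n^*\in S_{X^*}$ such that $d(x_n^*,Z_n)<\varepsilon2^{-n}$. Player $S$ wins if $(k_n,x_n^*)_{n=1}^\infty\in\overline{A}_{5\varepsilon}$; otherwise $P$ wins. A normalized even tree in $X^*$ is a family $(x^*_\alpha)$ in $S_{X^*}$ indexed by all $\alpha=(n_1,\dots,n_{2\ell})$ with $\ell\ge1$ and $n_1<\dots<n_{2\ell}$ in $\mathbb N$. It is $w^*$-null if for all $\ell\ge1$ and $n_1<\dots<n_{2\ell-1}$ the node $(x^*_{(n_1,\dots,n_{2\ell-1},k)})_{k>n_{2\ell-1}}$ is a $w^*$-null sequence. Its branches are the sequences $(n_{2\ell-1},x^*_{(n_1,\dots,n_{2\ell})})_{\ell=1}^\infty$ with $(n_i)_{i=1}^\infty\in[\mathbb N]^\omega$. The following are equivalent. 1. For all $\varepsilon>0$ there exist $(K_i)_{i=1}^\infty\in[\mathbb N]^\omega$, $(\delta_i)_{i=1}^\infty\subset(0,1)$ with $\delta_i\searrow0$, and $(p_i)_{i=1}^\infty\in[\mathbb N]^\omega$ such that whenever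 $(y_i^*)_{i=1}^\infty\subset S_{X^*}$ and $(r_i)_{i=0}^\infty\in[\mathbb N]^\omega$ satisfy, for all $i\ge1$, $$\sup_{p_{r_{i-1}+1}\ge n\ge m\ge1}\Big\|\sum_{j=m}^n y_i^*(x_j)f_j\Big\|<\delta_i\quad\text{and}\quad\sup_{n\ge m\ge p_{r_i}}\Big\|\sum_{j=m}^n y_i^*(x_j)f_j\Big\|<\delta_i,$$ then $(K_{r_{i-1}},y_i^*)_{i=1}^\infty\in\overline{A}_\varepsilon$. 2. For all $\varepsilon>0$, player $S$ has a winning strategy for the $(A,\varepsilon)$-game. 3. For all $\varepsilon>0$, every normalized $w^*$-null even tree in $X^*$ has a branch in $\overline{A}_\varepsilon$. -/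

import Mathlib

open Filter Topology

namespace FrameGame

/-! Conventions. All sequences are indexed from `0`, so the `i`-th term here is the `(i+1)`-st term
in the indexing by positive integers; accordingly `2⁻ⁱ` becomes `2⁻⁽ⁱ⁺¹⁾`. -/

variable {𝕜 : Type*} [RCLike 𝕜] {X : Type*} [NormedAddCommGroup X] [NormedSpace 𝕜 X]

/-- `(x i, f i)` is a Schauder frame: `v = ∑ i, f i v • x i` for every `v`, the partial sums
converging in norm. -/
def IsSchauderFrame (x : ℕ → X) (f : ℕ → StrongDual 𝕜 X) : Prop :=
  ∀ v : X, Tendsto (fun N => ∑ i ∈ Finset.range N, f i v • x i) atTop (𝓝 v)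

/-- The tail operator `T n v = ∑_{i ≥ n} f i v • x i` of a Schauder frame, written as the identity
minus a partial sum operator (see `tendsto_frameTail`). -/
noncomputable def frameTail (x : ℕ → X) (f : ℕ → StrongDual 𝕜 X) (n : ℕ) : X →L[𝕜] X :=
  ContinuousLinearMap.id 𝕜 X - ∑ i ∈ Finset.range n, (f i).smulRight (x i)

/-- For a Schauder frame, `frameTail x f n v` is the sum of the series `∑_{i ≥ n} f i v • x i`. -/
theorem tendsto_frameTail {x : ℕ → X} {f : ℕ → StrongDual 𝕜 X} (h : IsSchauderFrame x f)
    (n : ℕ) (v : X) :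
    Tendsto (fun N => ∑ i ∈ Finset.Ico n N, f i v • x i) atTop (𝓝 (frameTail x f n v)) := by
  have e : frameTail x f n v = v - ∑ i ∈ Finset.range n, f i v • x i := by
    simp [frameTail]
  rw [e]
  refine ((h v).sub_const _).congr' ?_
  filter_upwards [eventually_ge_atTop n] with N hN
  rw [Finset.sum_Ico_eq_sub _ hN]

/-- A Schauder frame is shrinking if `‖x* ∘ T n‖ → 0` for every `x*` in the dual. -/
def IsShrinking (x : ℕ → X) (f : ℕ → StrongDual 𝕜 X) : Prop :=
  ∀ φ : StrongDual 𝕜 X, Tendsto (fun n => ‖φ.comp (frameTail x f n)‖) atTop (𝓝 0)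

/-- The unit sphere of the dual space, with the norm topology. -/
abbrev DualSphere (𝕜 X : Type*) [RCLike 𝕜] [NormedAddCommGroup X] [NormedSpace 𝕜 X] : Type _ :=
  Metric.sphere (0 : StrongDual 𝕜 X) 1

/-- The set `A_ε`: sequences `(l i, y i)` for which some `(k i, x i)` in `A` satisfies
`k i ≤ l i` and `‖x i - y i‖ < ε 2⁻⁽ⁱ⁺¹⁾` for all `i`. -/
def fatten (A : Set (ℕ → ℕ × DualSphere 𝕜 X)) (ε : ℝ) : Set (ℕ → ℕ × DualSphere 𝕜 X) :=
  {b | ∃ a ∈ A, ∀ i, (a i).1 ≤ (b i).1 ∧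
    ‖((a i).2 : StrongDual 𝕜 X) - ((b i).2 : StrongDual 𝕜 X)‖ < ε * (2⁻¹ : ℝ) ^ (i + 1)}

/-- The closure of `A_ε` in the product space `(ℕ × S_{X*})^ω`. -/
def fattenClosure (A : Set (ℕ → ℕ × DualSphere 𝕜 X)) (ε : ℝ) : Set (ℕ → ℕ × DualSphere 𝕜 X) :=
  closure (fatten A ε)

/-- Weak-star closed subspaces of finite codimension in the dual space. -/
structure CofiniteSubspace (𝕜 X : Type*) [RCLike 𝕜] [NormedAddCommGroup X] [NormedSpace 𝕜 X] where
  toSubmodule : Submodule 𝕜 (StrongDual 𝕜 X)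
  isClosed' : IsClosed ((StrongDual.toWeakDual : StrongDual 𝕜 X ≃ₗ[𝕜] WeakDual 𝕜 X) ''
    (toSubmodule : Set (StrongDual 𝕜 X)))
  finiteDimensional_quotient : FiniteDimensional 𝕜 (StrongDual 𝕜 X ⧸ toSubmodule)

/-- A strategy for player S: given the list of the previous choices of player P, in order, it
produces the next natural number and the next subspace. -/
abbrev Strategy (𝕜 X : Type*) [RCLike 𝕜] [NormedAddCommGroup X] [NormedSpace 𝕜 X] : Type _ :=
  List (DualSphere 𝕜 X) → ℕ × CofiniteSubspace 𝕜 X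

/-- The move of S in round `n` when S follows `σ` and P plays the sequence `y`. -/
def Strategy.move (σ : Strategy 𝕜 X) (y : ℕ → DualSphere 𝕜 X) (n : ℕ) :
    ℕ × CofiniteSubspace 𝕜 X :=
  σ ((List.range n).map y)

/-- `σ` wins the `(A, ε)`-game for S: whenever P answers legally, that is, within distance less
than `ε 2⁻⁽ⁿ⁺¹⁾` of the subspace chosen by S in each round `n`, the sequence produced by the two
players lies in the closure of `A_{5ε}`. -/
def Strategy.IsWinning (σ : Strategy 𝕜 X) (A : Set (ℕ → ℕ × DualSphere 𝕜 X)) (ε : ℝ) : Prop :=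
  ∀ y : ℕ → DualSphere 𝕜 X,
    (∀ n, Metric.infDist (y n : StrongDual 𝕜 X)
      ((σ.move y n).2.toSubmodule : Set (StrongDual 𝕜 X)) < ε * (2⁻¹ : ℝ) ^ (n + 1)) →
    (fun n => ((σ.move y n).1, y n)) ∈ fattenClosure A (5 * ε)

/-- The index set of even trees: strictly increasing finite sequences of positive even length. -/
def EvenIndex : Type :=
  {s : List ℕ // s.Pairwise (· < ·) ∧ Even s.length ∧ s ≠ []}

/-- The index `(s, k)` for a strictly increasing `s` of odd length and `k` larger than all
entries of `s`. -/
def EvenIndex.snoc (s : List ℕ) (hs : s.Pairwise (· < ·)) (ho : Odd s.length)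
    (k : {k : ℕ // ∀ a ∈ s, a < k}) : EvenIndex :=
  ⟨s ++ [k.1], by
    rw [List.pairwise_append]
    exact ⟨hs, List.pairwise_singleton _ _, fun a ha b hb => by
      rw [List.mem_singleton.1 hb]; exact k.2 a ha⟩,
    by simpa using ho.add_one, by simp⟩

/-- The index `(n 0, …, n (2ℓ+1))`. -/
def EvenIndex.initial (n : ℕ → ℕ) (hn : StrictMono n) (ℓ : ℕ) : EvenIndex :=
  ⟨(List.range (2 * ℓ + 2)).map n, by
    rw [List.pairwise_map]
    exact List.pairwise_lt_range.imp (fun h => hn h),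
    by rw [List.length_map, List.length_range]; exact ⟨ℓ + 1, by omega⟩, by simp⟩

/-- A normalized even tree in the dual space. -/
abbrev NormalizedEvenTree (𝕜 X : Type*) [RCLike 𝕜] [NormedAddCommGroup X] [NormedSpace 𝕜 X] :
    Type _ :=
  EvenIndex → DualSphere 𝕜 X

/-- The tree is weak-star null: each node `k ↦ t (s, k)`, `k > max s`, with `s` strictly increasing
of odd length, is a weak-star null sequence. -/
def NormalizedEvenTree.IsWeakStarNull (t : NormalizedEvenTree 𝕜 X) : Prop :=
  ∀ (s : List ℕ) (hs : s.Pairwise (· < ·)) (ho : Odd s.length),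
    Tendsto (fun k : {k : ℕ // ∀ a ∈ s, a < k} =>
      StrongDual.toWeakDual (t (EvenIndex.snoc s hs ho k) : StrongDual 𝕜 X)) atTop (𝓝 0)

/-- The branch of `t` along the strictly increasing sequence `n`: its `ℓ`-th term is
`(n (2ℓ), t (n 0, …, n (2ℓ+1)))`. -/
def NormalizedEvenTree.branch (t : NormalizedEvenTree 𝕜 X) (n : ℕ → ℕ) (hn : StrictMono n) :
    ℕ → ℕ × DualSphere 𝕜 X :=
  fun ℓ => (n (2 * ℓ), t (EvenIndex.initial n hn ℓ))

end FrameGame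

/-!
Write `P n φ = ∑_{j < n} φ (x j) • f j = φ - φ ∘ T n` on the dual. A shrinking frame makes
`P n φ → φ` in norm, while `T n v → 0` for every `v` makes `φ ∘ T n` tend to zero weak-star for
bounded `φ`, even when `φ` varies with `n`. The three statements are proved in the cycle
1 → 3 → 2 → 1.

*1 → 3.* Along a weak-star null node the coordinates `φ (x j)`, `j ≤ p`, tend to zero, and each
functional has small tails by shrinking. So a branch satisfying the two smallness conditions can be
picked node by node, with the integers taken large
(`NormalizedEvenTree.IsWeakStarNull.exists_branch_mem`).

*3 → 2.* Consider the simplified game in which the subspaces are the annihilators of the first `m`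
frame vectors, replies are exactly in these subspaces, and the target is the closed set
`closure A_ε`. A winning strategy for the second player assembles into a weak-star null tree
without branches in the target (`ReplierWins.exists_tree`), contradicting 3. As the target is
closed, the game is determined (Gale–Stewart), so the first player wins it. In the original game the
replies are first moved onto the spheres of the annihilators, which costs `3 ε`
(`exists_isWinning_of_not_replierWins`, `mem_fattenClosure_of_perturb`).

*2 → 1.* Functionals satisfying the conditions in 1 are nearly in the span of finitely many `f j`,
so they can be replaced by points of finite nets. Only finitely many histories then have to be
considered at each stage; hence one `K n` bounds the integers picked by the strategy, and one
`p (n + 1)` makes every functional with small coordinates up to `p (n + 1)` close to all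
subspaces picked by the strategy (`Strategy.IsWinning.exists_uniform`). The latter rests on the fact
that weak-star convergence to zero forces convergence of the distance to a weak-star closed
subspace of finite codimension (`CofiniteSubspace.tendsto_infDist_zero`).
-/

namespace FrameGame

variable {𝕜 : Type*} [RCLike 𝕜] {X : Type*} [NormedAddCommGroup X] [NormedSpace 𝕜 X]

/-! ### Perturbing sequences in the closure of a fattened set -/

/-- The closure of `A_ε` absorbs enlargements of the integers and, at the price of a larger `ε`,
perturbations of the functionals. -/
theorem mem_fattenClosure_of_perturb {A : Set (ℕ → ℕ × DualSphere 𝕜 X)} {ε η : ℝ}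
    {b c : ℕ → ℕ × DualSphere 𝕜 X} (hb : b ∈ fattenClosure A ε) (hle : ∀ i, (b i).1 ≤ (c i).1)
    (hd : ∀ i, ‖((b i).2 : StrongDual 𝕜 X) - (c i).2‖ < η * (2⁻¹ : ℝ) ^ (i + 1)) :
    c ∈ fattenClosure A (ε + η) := by
  classical
  -- Any `b'` in `A_ε` close to `b` on the first `N` coordinates stays in the fattened set after
  -- these coordinates are replaced by those of `c`, and the results converge to `c`.
  have key : ∀ N : ℕ, ∃ c' ∈ fatten A (ε + η), ∀ i < N, c' i = c i := by
    intro N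
    set U : Set (ℕ → ℕ × DualSphere 𝕜 X) :=
      ⋂ i ∈ Finset.range N, {b' | (b' i).1 = (b i).1} ∩
        {b' | ‖((b' i).2 : StrongDual 𝕜 X) - (c i).2‖ < η * (2⁻¹ : ℝ) ^ (i + 1)} with hU
    have hUo : IsOpen U := by
      refine isOpen_biInter_finset fun i _ => IsOpen.inter ?_ ?_
      · exact (isOpen_discrete ({(b i).1} : Set ℕ)).preimage
          (continuous_fst.comp (continuous_apply (A := fun _ : ℕ => ℕ × DualSphere 𝕜 X) i))
      · refine isOpen_lt (continuous_norm.comp (Continuous.sub ?_ continuous_const)) continuous_const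
        exact continuous_subtype_val.comp (continuous_snd.comp (continuous_apply i))
    have hbU : b ∈ U := by
      simp only [hU, Set.mem_iInter, Set.mem_inter_iff, Set.mem_ofPred_eq]
      exact fun i _ => ⟨trivial, hd i⟩
    obtain ⟨b', hb'U, a, ha, hab⟩ := mem_closure_iff.1 hb U hUo hbU
    simp only [hU, Set.mem_iInter, Set.mem_inter_iff, Set.mem_ofPred_eq, Finset.mem_range] at hb'U
    have hη : ∀ i, 0 ≤ η * (2⁻¹ : ℝ) ^ (i + 1) := fun i => (norm_nonneg _).trans (hd i).le
    refine ⟨fun i => if i < N then c i else b' i, ⟨a, ha, fun i => ?_⟩, fun i hi => if_pos hi⟩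
    by_cases hi : i < N
    · simp only [hi, if_true]
      refine ⟨(hab i).1.trans ((hb'U i hi).1.le.trans (hle i)), ?_⟩
      rw [add_mul]
      exact (norm_sub_le_norm_sub_add_norm_sub _ _ _).trans_lt
        (add_lt_add (hab i).2 (hb'U i hi).2)
    · simp only [hi, if_false]
      exact ⟨(hab i).1, (hab i).2.trans_le (by rw [add_mul]; linarith [hη i])⟩
  choose c' hc' hcc using key
  refine mem_closure_of_tendsto (b := atTop) (f := c') ?_ (Eventually.of_forall hc')
  refine tendsto_pi_nhds.2 fun i => tendsto_const_nhds.congr' ?_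
  filter_upwards [eventually_gt_atTop i] with N hN using (hcc N i hN).symm

/-- The closure of `A_ε` is stable under enlarging the integers. -/
theorem mem_fattenClosure_of_le {A : Set (ℕ → ℕ × DualSphere 𝕜 X)} {ε : ℝ} {k l : ℕ → ℕ}
    {y : ℕ → DualSphere 𝕜 X} (h : (fun i => (k i, y i)) ∈ fattenClosure A ε)
    (hle : ∀ i, k i ≤ l i) : (fun i => (l i, y i)) ∈ fattenClosure A ε := by
  have hcont : Continuous fun b : ℕ → ℕ × DualSphere 𝕜 X =>
      fun i => ((b i).1 + (l i - k i), (b i).2) := by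
    refine continuous_pi fun i => Continuous.prodMk ?_ (by fun_prop)
    exact (continuous_of_discreteTopology (f := fun m : ℕ => m + (l i - k i))).comp
      (continuous_fst.comp (continuous_apply i))
  have := map_mem_closure (t := fatten A ε) hcont h (by
    rintro b ⟨a, ha, hab⟩
    exact ⟨a, ha, fun i => ⟨(hab i).1.trans (Nat.le_add_right _ _), (hab i).2⟩⟩)
  simp only [Nat.add_sub_cancel' (hle _)] at this
  exact this

theorem fattenClosure_mono {A : Set (ℕ → ℕ × DualSphere 𝕜 X)} {ε ε' : ℝ} (h : ε ≤ ε') :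
    fattenClosure A ε ⊆ fattenClosure A ε' := by
  refine closure_mono fun b ⟨a, ha, hab⟩ => ⟨a, ha, fun i => ⟨(hab i).1, (hab i).2.trans_le ?_⟩⟩
  gcongr

/-! ### The dual expansion of a shrinking Schauder frame -/

theorem comp_frameTail (x : ℕ → X) (f : ℕ → StrongDual 𝕜 X) (n : ℕ) (φ : StrongDual 𝕜 X) :
    φ.comp (frameTail x f n) = φ - ∑ j ∈ Finset.range n, φ (x j) • f j := by
  ext v
  simp [frameTail, mul_comm]

theorem sum_Icc_eq_sub_comp_frameTail (x : ℕ → X) (f : ℕ → StrongDual 𝕜 X) {m n : ℕ} (h : m ≤ n)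
    (φ : StrongDual 𝕜 X) :
    ∑ j ∈ Finset.Icc m n, φ (x j) • f j =
      φ.comp (frameTail x f m) - φ.comp (frameTail x f (n + 1)) := by
  rw [comp_frameTail, comp_frameTail, ← Finset.Ico_add_one_right_eq_Icc,
    Finset.sum_Ico_eq_sub _ (by omega : m ≤ n + 1)]
  abel

theorem tendsto_frameTail_zero {x : ℕ → X} {f : ℕ → StrongDual 𝕜 X} (h : IsSchauderFrame x f)
    (v : X) : Tendsto (fun n => frameTail x f n v) atTop (𝓝 0) := by
  have := (h v).const_sub v
  rw [sub_self] at this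
  exact this.congr fun n => by simp [frameTail]

/-- Functionals of norm at most one composed with the tail operators of a Schauder frame tend to
zero pointwise, hence weak-star. -/
theorem tendsto_comp_frameTail_apply {x : ℕ → X} {f : ℕ → StrongDual 𝕜 X}
    (h : IsSchauderFrame x f) {y : ℕ → StrongDual 𝕜 X} (hy : ∀ n, ‖y n‖ ≤ 1) (v : X) :
    Tendsto (fun n => (y n).comp (frameTail x f n) v) atTop (𝓝 0) := by
  refine squeeze_zero_norm (fun n => ?_) (tendsto_norm_zero.comp (tendsto_frameTail_zero h v))
  exact ((y n).le_of_opNorm_le (hy n) _).trans (by simp)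

/-- A sequence in the unit ball of the dual whose `n`-th term annihilates the first `n` frame
vectors tends to zero pointwise. -/
theorem tendsto_apply_zero_of_annihilates {x : ℕ → X} {f : ℕ → StrongDual 𝕜 X}
    (h : IsSchauderFrame x f) {y : ℕ → StrongDual 𝕜 X} (hy : ∀ n, ‖y n‖ ≤ 1)
    (h0 : ∀ n, ∀ j < n, y n (x j) = 0) (v : X) :
    Tendsto (fun n => y n v) atTop (𝓝 0) := by
  refine (tendsto_comp_frameTail_apply h hy v).congr fun n => ?_
  rw [comp_frameTail, Finset.sum_eq_zero fun j hj => by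
    ext; simp [h0 n j (Finset.mem_range.1 hj)],
    sub_zero]

theorem tendsto_toWeakDual_zero_iff {α : Type*} {l : Filter α} {y : α → StrongDual 𝕜 X} :
    Tendsto (fun a => StrongDual.toWeakDual (y a)) l (𝓝 0) ↔
      ∀ v, Tendsto (fun a => y a v) l (𝓝 0) :=
  tendsto_iff_forall_eval_tendsto_topDualPairing

/-! ### Weak-star closed subspaces of finite codimension -/

/-- Let `e` transport a normed space onto a topological vector space, and let `Z` have finite
codimension and closed image. If `e (y a)` tends to zero, so does the distance of `y a` to `Z`: the
quotient by the image of `Z` is a finite-dimensional Hausdorff space, so its identification with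
the normed quotient by `Z` is continuous. -/
theorem tendsto_infDist_zero_of_linearEquiv {V W : Type*} [SeminormedAddCommGroup V]
    [NormedSpace 𝕜 V] [AddCommGroup W] [Module 𝕜 W] [TopologicalSpace W] [IsTopologicalAddGroup W]
    [ContinuousSMul 𝕜 W] (e : V ≃ₗ[𝕜] W) (Z : Submodule 𝕜 V) [FiniteDimensional 𝕜 (V ⧸ Z)]
    (hZ : IsClosed (e '' (Z : Set V))) {α : Type*} {l : Filter α} {y : α → V}
    (h : Tendsto (fun a => e (y a)) l (𝓝 0)) :
    Tendsto (fun a => Metric.infDist (y a) (Z : Set V)) l (𝓝 0) := by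
  let Z' : Submodule 𝕜 W := Z.map e.toLinearMap
  have hZ' : IsClosed (Z' : Set W) := hZ
  let E : (V ⧸ Z) ≃ₗ[𝕜] (W ⧸ Z') := Submodule.Quotient.equiv Z Z' e rfl
  have : FiniteDimensional 𝕜 (W ⧸ Z') := E.finiteDimensional
  have : T3Space (W ⧸ Z') := Submodule.t3_quotient_of_isClosed Z'
  have hE : Continuous fun q => ‖E.symm q‖ :=
    continuous_norm.comp (LinearMap.continuous_of_finiteDimensional E.symm.toLinearMap)
  have hq : Continuous Z'.mkQ := continuous_quot_mk
  have ht := ((hE.comp hq).tendsto 0).comp h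
  simp only [Function.comp_apply, map_zero, norm_zero] at ht
  refine ht.congr fun a => ?_
  have h1 : E.symm (Z'.mkQ (e (y a))) = Z.mkQ (y a) := by
    rw [LinearEquiv.symm_apply_eq]; rfl
  change ‖E.symm (Z'.mkQ (e (y a)))‖ = _
  rw [h1]
  exact QuotientAddGroup.norm_mk (S := Z.toAddSubgroup) (y a)

theorem CofiniteSubspace.tendsto_infDist_zero (Z : CofiniteSubspace 𝕜 X) {α : Type*} {l : Filter α}
    {y : α → StrongDual 𝕜 X} (h : ∀ v, Tendsto (fun a => y a v) l (𝓝 0)) :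
    Tendsto (fun a => Metric.infDist (y a) (Z.toSubmodule : Set (StrongDual 𝕜 X))) l (𝓝 0) := by
  have := Z.finiteDimensional_quotient
  exact tendsto_infDist_zero_of_linearEquiv _ _ Z.isClosed' (tendsto_toWeakDual_zero_iff.2 h)

/-- The functionals `φ ∘ T n` with `‖φ‖ ≤ 1` are, for large `n`, uniformly close to a given
weak-star closed subspace of finite codimension. -/
theorem CofiniteSubspace.exists_infDist_comp_frameTail_lt (Z : CofiniteSubspace 𝕜 X)
    {x : ℕ → X} {f : ℕ → StrongDual 𝕜 X} (h : IsSchauderFrame x f) {η : ℝ} (hη : 0 < η) :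
    ∃ N, ∀ n ≥ N, ∀ φ : StrongDual 𝕜 X, ‖φ‖ ≤ 1 →
      Metric.infDist (φ.comp (frameTail x f n)) (Z.toSubmodule : Set (StrongDual 𝕜 X)) < η := by
  have key : ∀ n, ∃ φ : StrongDual 𝕜 X, ‖φ‖ ≤ 1 ∧ ∀ ψ : StrongDual 𝕜 X, ‖ψ‖ ≤ 1 →
      Metric.infDist (φ.comp (frameTail x f n)) (Z.toSubmodule : Set (StrongDual 𝕜 X)) < η →
      Metric.infDist (ψ.comp (frameTail x f n)) (Z.toSubmodule : Set (StrongDual 𝕜 X)) < η := by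
    intro n
    by_cases hn : ∃ φ : StrongDual 𝕜 X, ‖φ‖ ≤ 1 ∧
        ¬ Metric.infDist (φ.comp (frameTail x f n)) (Z.toSubmodule : Set (StrongDual 𝕜 X)) < η
    · obtain ⟨φ, hφ, hφ'⟩ := hn
      exact ⟨φ, hφ, fun ψ _ h => absurd h hφ'⟩
    · push Not at hn
      exact ⟨0, by simp, fun ψ hψ _ => hn ψ hψ⟩
  choose φ hφ hψ using key
  have ht := Z.tendsto_infDist_zero (tendsto_comp_frameTail_apply h hφ)
  obtain ⟨N, hN⟩ := eventually_atTop.1 (ht.eventually_lt_const hη)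
  exact ⟨N, fun n hn ψ h1 => hψ n ψ h1 (hN n hn)⟩

/-- The subspace of functionals annihilating the first `m` vectors of a sequence. -/
noncomputable def annihilator (𝕜 : Type*) [RCLike 𝕜] {X : Type*} [NormedAddCommGroup X]
    [NormedSpace 𝕜 X] (x : ℕ → X) (m : ℕ) : CofiniteSubspace 𝕜 X where
  toSubmodule := LinearMap.ker
    (LinearMap.pi fun j : Fin m => (ContinuousLinearMap.apply 𝕜 𝕜 (x j)).toLinearMap)
  isClosed' := by
    have : IsClosed (⋂ j : Fin m, {φ : WeakDual 𝕜 X | φ (x j) = 0}) :=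
      isClosed_iInter fun j => isClosed_eq (WeakDual.eval_continuous _) continuous_const
    convert this using 1
    ext φ
    simp only [Set.mem_image, SetLike.mem_coe, LinearMap.mem_ker, Set.mem_iInter,
      Set.mem_ofPred_eq]
    constructor
    · rintro ⟨ψ, hψ, rfl⟩ j
      exact congrFun hψ j
    · exact fun h => ⟨WeakDual.toStrongDual φ, funext h, rfl⟩
  finiteDimensional_quotient :=
    (LinearMap.quotKerEquivRange _).symm.finiteDimensional

theorem mem_annihilator {x : ℕ → X} {m : ℕ} {φ : StrongDual 𝕜 X} :
    φ ∈ (annihilator 𝕜 x m).toSubmodule ↔ ∀ j < m, φ (x j) = 0 :=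
  ⟨fun h j hj => congrFun h ⟨j, hj⟩, fun h => funext fun j => h j j.2⟩

theorem not_finiteDimensional_strongDual (hX : ¬ FiniteDimensional 𝕜 X) :
    ¬ FiniteDimensional 𝕜 (StrongDual 𝕜 X) := by
  intro h
  have hinj : Function.Injective (topDualPairing 𝕜 X).flip := fun v w hvw =>
    (NormedSpace.inclusionInDoubleDualLi (E := X) 𝕜).injective <|
      ContinuousLinearMap.ext fun φ => LinearMap.congr_fun hvw φ
  exact hX (Module.Finite.of_injective _ hinj)

theorem CofiniteSubspace.exists_mem_sphere (hX : ¬ FiniteDimensional 𝕜 X)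
    (Z : CofiniteSubspace 𝕜 X) :
    ∃ z : DualSphere 𝕜 X, (z : StrongDual 𝕜 X) ∈ Z.toSubmodule := by
  have hne : Z.toSubmodule ≠ ⊥ := by
    intro h
    have := Z.finiteDimensional_quotient
    have : FiniteDimensional 𝕜 Z.toSubmodule := by rw [h]; infer_instance
    exact not_finiteDimensional_strongDual hX (Module.Finite.of_submodule_quotient Z.toSubmodule)
  obtain ⟨z, hz, h0⟩ := Submodule.exists_mem_ne_zero_of_ne_bot hne
  exact ⟨⟨((‖z‖⁻¹ : ℝ) : 𝕜) • z, by simp [norm_smul, h0]⟩, Z.toSubmodule.smul_mem _ hz⟩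

/-- A unit functional can be moved into the unit sphere of a weak-star closed subspace of finite
codimension at the cost of at most three times its distance to the subspace. -/
theorem CofiniteSubspace.exists_mem_sphere_norm_sub_le (hX : ¬ FiniteDimensional 𝕜 X)
    (Z : CofiniteSubspace 𝕜 X) (y : DualSphere 𝕜 X) :
    ∃ z : DualSphere 𝕜 X, (z : StrongDual 𝕜 X) ∈ Z.toSubmodule ∧
      ‖(z : StrongDual 𝕜 X) - y‖ ≤
        3 * Metric.infDist (y : StrongDual 𝕜 X) (Z.toSubmodule : Set (StrongDual 𝕜 X)) := by
  have hcl : IsClosed (Z.toSubmodule : Set (StrongDual 𝕜 X)) := by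
    have := Z.isClosed'.preimage (NormedSpace.Dual.toWeakDual_continuous (𝕜 := 𝕜) (E := X))
    rwa [Set.preimage_image_eq _ (StrongDual.toWeakDual (𝕜 := 𝕜) (E := X)).injective] at this
  have hne : (Z.toSubmodule : Set (StrongDual 𝕜 X)).Nonempty := ⟨0, Z.toSubmodule.zero_mem⟩
  have hy : ‖(y : StrongDual 𝕜 X)‖ = 1 := mem_sphere_zero_iff_norm.1 y.2
  set d := Metric.infDist (y : StrongDual 𝕜 X) (Z.toSubmodule : Set (StrongDual 𝕜 X)) with hd
  rcases (Metric.infDist_nonneg (x := (y : StrongDual 𝕜 X))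
    (s := (Z.toSubmodule : Set (StrongDual 𝕜 X)))).eq_or_lt with h0 | h0
  · exact ⟨y, (hcl.mem_iff_infDist_zero hne).2 h0.symm, by simp [hd, ← h0]⟩
  obtain ⟨z, hz, hzd⟩ := (Metric.infDist_lt_iff hne).1
    (show d < 3 / 2 * d by linarith)
  rw [dist_eq_norm] at hzd
  by_cases hz0 : z = 0
  · -- Here `1 = ‖y‖ < 3 / 2 * d`, so any two unit vectors are at distance at most `3 * d`.
    obtain ⟨w, hw⟩ := Z.exists_mem_sphere hX
    refine ⟨w, hw, (norm_sub_le _ _).trans ?_⟩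
    rw [hz0, sub_zero, hy] at hzd
    rw [hy, mem_sphere_zero_iff_norm.1 w.2]
    linarith
  · have hzn : 0 < ‖z‖ := norm_pos_iff.2 hz0
    refine ⟨⟨((‖z‖⁻¹ : ℝ) : 𝕜) • z, by simp [norm_smul, hz0]⟩, Z.toSubmodule.smul_mem _ hz, ?_⟩
    have h1 : ‖((‖z‖⁻¹ : ℝ) : 𝕜) • z - z‖ = |1 - ‖z‖| := by
      have : ((‖z‖⁻¹ : ℝ) : 𝕜) • z - z = ((‖z‖⁻¹ - 1 : ℝ) : 𝕜) • z := by
        push_cast; rw [sub_smul (M := StrongDual 𝕜 X), one_smul]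
      rw [this, norm_smul, RCLike.norm_ofReal]
      nth_rw 2 [← abs_of_pos hzn]
      rw [← abs_mul, sub_mul, inv_mul_cancel₀ hzn.ne', one_mul]
    have h2 : |1 - ‖z‖| ≤ ‖(y : StrongDual 𝕜 X) - z‖ := by
      have := abs_norm_sub_norm_le (y : StrongDual 𝕜 X) z
      rwa [hy] at this
    have h3 := norm_sub_le_norm_sub_add_norm_sub (((‖z‖⁻¹ : ℝ) : 𝕜) • z) z (y : StrongDual 𝕜 X)
    rw [norm_sub_rev z] at h3
    change ‖((‖z‖⁻¹ : ℝ) : 𝕜) • z - (y : StrongDual 𝕜 X)‖ ≤ _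
    linarith

/-! ### Finding branches in weak-star null trees -/

theorem iSup_enorm_lt_ofReal {ι E : Type*} [SeminormedAddCommGroup E] {P : ι → ι → Prop}
    {g : ι → ι → E} {δ : ℝ} (hδ : 0 < δ) (h : ∀ m n, P m n → ‖g m n‖ < δ / 2) :
    (⨆ (m : ι) (n : ι) (_ : P m n), ‖g m n‖ₑ) < ENNReal.ofReal δ := by
  refine lt_of_le_of_lt (b := ENNReal.ofReal (δ / 2)) ?_
    ((ENNReal.ofReal_lt_ofReal_iff hδ).2 (half_lt_self hδ))
  refine iSup_le fun m => iSup_le fun n => iSup_le fun hmn => ?_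
  rw [← ofReal_norm]
  exact ENNReal.ofReal_le_ofReal (h m n hmn).le

theorem eventually_norm_sum_Icc_lt (x : ℕ → X) (f : ℕ → StrongDual 𝕜 X) {α : Type*} {l : Filter α}
    {y : α → StrongDual 𝕜 X} (h : ∀ v, Tendsto (fun k => y k v) l (𝓝 0)) (p : ℕ) {δ : ℝ}
    (hδ : 0 < δ) :
    ∀ᶠ k in l, ∀ m n, m ≤ n ∧ n ≤ p → ‖∑ j ∈ Finset.Icc m n, y k (x j) • f j‖ < δ := by
  have ht : Tendsto (fun k => ∑ j ∈ Finset.range (p + 1), ‖y k (x j) • f j‖) l (𝓝 0) := by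
    rw [← Finset.sum_const_zero (s := Finset.range (p + 1))]
    refine tendsto_finsetSum _ fun j _ => ?_
    simpa [norm_smul] using ((tendsto_norm_zero.comp (h (x j))).mul_const ‖f j‖)
  filter_upwards [ht.eventually_lt_const hδ] with k hk m n hmn
  refine ((norm_sum_le _ _).trans ?_).trans_lt hk
  refine Finset.sum_le_sum_of_subset_of_nonneg (fun j hj => ?_) fun _ _ _ => norm_nonneg _
  have := (Finset.mem_Icc.1 hj).2
  simp; omega

theorem IsShrinking.eventually_norm_sum_Icc_lt {x : ℕ → X} {f : ℕ → StrongDual 𝕜 X}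
    (h : IsShrinking x f) (φ : StrongDual 𝕜 X) {δ : ℝ} (hδ : 0 < δ) :
    ∀ᶠ N in atTop, ∀ m n, N ≤ m ∧ m ≤ n → ‖∑ j ∈ Finset.Icc m n, φ (x j) • f j‖ < δ := by
  obtain ⟨N₀, hN₀⟩ := eventually_atTop.1 ((h φ).eventually_lt_const (half_pos hδ))
  filter_upwards [eventually_ge_atTop N₀] with N hN m n hmn
  rw [sum_Icc_eq_sub_comp_frameTail x f hmn.2]
  refine (norm_sub_le _ _).trans_lt ?_
  linarith [hN₀ m (by omega), hN₀ (n + 1) (by omega)]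

open Classical in
/-- A normalized even tree as a function on all lists; its values off the index set are
irrelevant. -/
noncomputable def NormalizedEvenTree.extend (t : NormalizedEvenTree 𝕜 X) (s : List ℕ) :
    DualSphere 𝕜 X :=
  if h : s.Pairwise (· < ·) ∧ Even s.length ∧ s ≠ [] then t ⟨s, h⟩
  else t ⟨[0, 1], by simp, by simp, by simp⟩

theorem NormalizedEvenTree.extend_initial (t : NormalizedEvenTree 𝕜 X) {n : ℕ → ℕ}
    (hn : StrictMono n) (ℓ : ℕ) :
    t.extend ((List.range (2 * ℓ + 2)).map n) = t (EvenIndex.initial n hn ℓ) :=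
  dif_pos (EvenIndex.initial n hn ℓ).2

theorem exists_forall_mem_lt (s : List ℕ) (N : ℕ) : ∃ k, N ≤ k ∧ ∀ a ∈ s, a < k :=
  ⟨N + s.sum + 1, by omega, fun a ha => by have := List.le_sum_of_mem ha; omega⟩

/-- A property that holds eventually along every weak-star null family of functionals holds at some
node directly above any given strictly increasing list of odd length. -/
theorem NormalizedEvenTree.IsWeakStarNull.exists_child {t : NormalizedEvenTree 𝕜 X}
    (ht : t.IsWeakStarNull) {s : List ℕ} (hs : s.Pairwise (· < ·)) (ho : Odd s.length)
    {P : StrongDual 𝕜 X → Prop}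
    (hP : ∀ {α : Type} {l : Filter α} {y : α → StrongDual 𝕜 X},
      (∀ v, Tendsto (fun k => y k v) l (𝓝 0)) → ∀ᶠ k in l, P (y k)) :
    ∃ b, (∀ a ∈ s, a < b) ∧ P (t.extend (s ++ [b])) := by
  have h := hP (tendsto_toWeakDual_zero_iff.1 (ht s hs ho))
  have : Nonempty {k : ℕ // ∀ a ∈ s, a < k} :=
    let ⟨k, _, hk⟩ := exists_forall_mem_lt s 0; ⟨⟨k, hk⟩⟩
  obtain ⟨b, hb⟩ := h.exists
  refine ⟨b, b.2, ?_⟩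
  have : t.extend (s ++ [b.1]) = t (EvenIndex.snoc s hs ho b) := dif_pos (EvenIndex.snoc s hs ho b).2
  rwa [this]

/-- A branch can be selected two indices at a time: if every strictly increasing list `s` of even
length and every state `i`, `r` admit indices `a < b` beyond `s` and a new `r' > r` with a
prescribed property `Q`, then some branch has this property throughout. -/
theorem exists_branch {τ : List ℕ → DualSphere 𝕜 X} {Q : ℕ → ℕ → ℕ → ℕ → DualSphere 𝕜 X → Prop}
    (h : ∀ (s : List ℕ) (i r : ℕ), s.Pairwise (· < ·) → Even s.length →
      ∃ a b r', (∀ c ∈ s, c < a) ∧ a < b ∧ r < r' ∧ Q i r r' a (τ (s ++ [a, b]))) :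
    ∃ n r : ℕ → ℕ, StrictMono n ∧ StrictMono r ∧
      ∀ i, Q i (r i) (r (i + 1)) (n (2 * i)) (τ ((List.range (2 * i + 2)).map n)) := by
  have h' : ∀ (s : List ℕ) (i r : ℕ), ∃ a b r', s.Pairwise (· < ·) → Even s.length →
      (∀ c ∈ s, c < a) ∧ a < b ∧ r < r' ∧ Q i r r' a (τ (s ++ [a, b])) := by
    intro s i r
    by_cases hs : s.Pairwise (· < ·) ∧ Even s.length
    · obtain ⟨a, b, r', hh⟩ := h s i r hs.1 hs.2
      exact ⟨a, b, r', fun _ _ => hh⟩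
    · exact ⟨0, 0, 0, fun h1 h2 => absurd ⟨h1, h2⟩ hs⟩
  choose a b r' hh using h'
  let st : ℕ → List ℕ × ℕ := fun i => i.rec ([], 0) fun i q =>
    (q.1 ++ [a q.1 i q.2, b q.1 i q.2], r' q.1 i q.2)
  have st_succ : ∀ i, st (i + 1) = ((st i).1 ++ [a (st i).1 i (st i).2, b (st i).1 i (st i).2],
    r' (st i).1 i (st i).2) := fun i => rfl
  have hst : ∀ i, (st i).1.Pairwise (· < ·) ∧ (st i).1.length = 2 * i := by
    intro i
    induction i with
    | zero => simp [st]
    | succ i ih =>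
      obtain ⟨h1, h2, -, -⟩ := hh (st i).1 i (st i).2 ih.1 (by rw [ih.2]; simp)
      rw [st_succ]
      refine ⟨?_, by simp [ih.2]; ring⟩
      refine List.pairwise_append.2 ⟨ih.1, by simpa using h2, fun c hc d hd => ?_⟩
      simp only [List.mem_cons, List.not_mem_nil, or_false] at hd
      rcases hd with rfl | rfl
      exacts [h1 c hc, (h1 c hc).trans h2]
  have hQ := fun i => hh (st i).1 i (st i).2 (hst i).1 (by rw [(hst i).2]; simp)
  let n : ℕ → ℕ := fun j => if j % 2 = 0 then a (st (j / 2)).1 (j / 2) (st (j / 2)).2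
    else b (st (j / 2)).1 (j / 2) (st (j / 2)).2
  have n_even : ∀ i, n (2 * i) = a (st i).1 i (st i).2 := fun i => by simp [n]
  have n_odd : ∀ i, n (2 * i + 1) = b (st i).1 i (st i).2 := fun i => by
    have h1 : (2 * i + 1) / 2 = i := by omega
    have h2 : (2 * i + 1) % 2 = 1 := by omega
    simp [n, h1, h2]
  have hmap : ∀ i, (List.range (2 * i)).map n = (st i).1 := by
    intro i
    induction i with
    | zero => simp [st]
    | succ i ih =>
      rw [st_succ, ← n_even, ← n_odd, ← ih, show 2 * (i + 1) = 2 * i + 1 + 1 by ring,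
        List.range_succ, List.range_succ]
      simp
  refine ⟨n, fun i => (st i).2, strictMono_nat_of_lt_succ fun j => ?_,
    strictMono_nat_of_lt_succ fun i => (hQ i).2.2.1, fun i => ?_⟩
  · obtain ⟨i, rfl | rfl⟩ := Nat.even_or_odd' j
    · rw [n_even, n_odd]; exact (hQ i).2.1
    · rw [show 2 * i + 1 + 1 = 2 * (i + 1) by ring, n_even]
      refine (hQ (i + 1)).1 _ ?_
      rw [n_odd, st_succ]; simp
  · rw [n_even, show 2 * i + 2 = 2 * (i + 1) by ring, hmap, st_succ]
    exact (hQ i).2.2.2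

/-- If smallness of the initial sums up to `p (r i + 1)` and of the tails from `p (r (i + 1))` on
forces membership in `closure A_ε`, then every weak-star null tree has a branch there: the indices
of the branch and the `r i` are chosen alternately. -/
theorem NormalizedEvenTree.IsWeakStarNull.exists_branch_mem {x : ℕ → X} {f : ℕ → StrongDual 𝕜 X}
    (hshrink : IsShrinking x f) {A : Set (ℕ → ℕ × DualSphere 𝕜 X)} {ε : ℝ} {K p : ℕ → ℕ}
    {δ : ℕ → ℝ} (hδ : ∀ i, 0 < δ i) (hp : StrictMono p)
    (h : ∀ (y : ℕ → DualSphere 𝕜 X) (r : ℕ → ℕ), StrictMono r →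
      (∀ i,
        (⨆ (m : ℕ) (n : ℕ) (_ : m ≤ n ∧ n ≤ p (r i + 1)),
          ‖∑ j ∈ Finset.Icc m n, (y i : StrongDual 𝕜 X) (x j) • f j‖ₑ)
            < ENNReal.ofReal (δ i) ∧
        (⨆ (m : ℕ) (n : ℕ) (_ : p (r (i + 1)) ≤ m ∧ m ≤ n),
          ‖∑ j ∈ Finset.Icc m n, (y i : StrongDual 𝕜 X) (x j) • f j‖ₑ)
            < ENNReal.ofReal (δ i)) →
      (fun i => (K (r i), y i)) ∈ fattenClosure A ε)
    {t : NormalizedEvenTree 𝕜 X} (ht : t.IsWeakStarNull) :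
    ∃ (n : ℕ → ℕ) (hn : StrictMono n), t.branch n hn ∈ fattenClosure A ε := by
  obtain ⟨n, r, hn, hr, hQ⟩ := exists_branch (τ := t.extend)
    (Q := fun i r r' a z => K r ≤ a ∧
      (∀ m n, m ≤ n ∧ n ≤ p (r + 1) →
        ‖∑ j ∈ Finset.Icc m n, (z : StrongDual 𝕜 X) (x j) • f j‖ < δ i / 2) ∧
      ∀ m n, p r' ≤ m ∧ m ≤ n →
        ‖∑ j ∈ Finset.Icc m n, (z : StrongDual 𝕜 X) (x j) • f j‖ < δ i / 2) (by
    intro s i r hs he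
    obtain ⟨a, hKa, ha⟩ := exists_forall_mem_lt s (K r)
    have hs' : (s ++ [a]).Pairwise (· < ·) :=
      List.pairwise_append.2 ⟨hs, List.pairwise_singleton _ _, by simpa using ha⟩
    obtain ⟨b, hb, hbP⟩ := ht.exists_child hs' (by simpa using he.add_one)
      (P := fun z => ∀ m n, m ≤ n ∧ n ≤ p (r + 1) →
        ‖∑ j ∈ Finset.Icc m n, z (x j) • f j‖ < δ i / 2)
      (fun hy => eventually_norm_sum_Icc_lt x f hy _ (half_pos (hδ i)))
    have htail := hshrink.eventually_norm_sum_Icc_lt (t.extend (s ++ [a, b]) : StrongDual 𝕜 X)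
      (half_pos (hδ i))
    obtain ⟨r', hr', hrr⟩ :=
      ((hp.tendsto_atTop.eventually htail).and (eventually_gt_atTop r)).exists
    rw [List.append_assoc] at hbP
    exact ⟨a, b, r', ha, hb a (by simp), hrr, hKa, hbP, hr'⟩)
  refine ⟨n, hn, ?_⟩
  have hmem := h (fun i => t (EvenIndex.initial n hn i)) r hr fun i => by
    have hi := hQ i
    rw [t.extend_initial hn] at hi
    exact ⟨iSup_enorm_lt_ofReal (hδ i) hi.2.1, iSup_enorm_lt_ofReal (hδ i) hi.2.2⟩
  exact mem_fattenClosure_of_le hmem fun i => (hQ i).1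

/-! ### Determinacy of the game -/

/-- The sequence `a, b 0, b 1, …`. -/
def cons {α : Type*} (a : α) (b : ℕ → α) (n : ℕ) : α :=
  n.casesOn a b

/-- The sequences that continue the first term `a` to a member of `C`. -/
def residual {α : Type*} (C : Set (ℕ → α)) (a : α) : Set (ℕ → α) :=
  {b | cons a b ∈ C}

/-- The second player has a winning strategy in the game in which the first player picks `k`, `m`,
the second player answers with a unit functional vanishing at `x 0, …, x (m - 1)`, and the first
player aims at the set `C`. The target after a round is the residual of `C` by that round; since
`C` will be closed, a win of the second player shows after finitely many rounds, as an empty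
residual, which makes an inductive definition possible. -/
inductive ReplierWins (x : ℕ → X) : Set (ℕ → ℕ × DualSphere 𝕜 X) → Prop
  | empty : ReplierWins x ∅
  | step (C : Set (ℕ → ℕ × DualSphere 𝕜 X)) (y : ℕ → ℕ → DualSphere 𝕜 X)
      (hy : ∀ k m, (y k m : StrongDual 𝕜 X) ∈ (annihilator 𝕜 x m).toSubmodule)
      (h : ∀ k m, ReplierWins x (residual C (k, y k m))) : ReplierWins x C

/-- The tree with nodes `y a b` on the first level and the trees `T a b` above them. -/
def graft {α : Type*} (y : ℕ → ℕ → α) (T : ℕ → ℕ → List ℕ → α) : List ℕ → α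
  | [a, b] => y a b
  | a :: b :: s => T a b s
  | _ => y 0 0

theorem graft_cons_cons {α : Type*} (y : ℕ → ℕ → α) (T : ℕ → ℕ → List ℕ → α) (a b : ℕ)
    {s : List ℕ} (hs : s ≠ []) : graft y T (a :: b :: s) = T a b s := by
  cases s with
  | nil => exact absurd rfl hs
  | cons c s => rfl

/-- A winning strategy of the second player yields a weak-star null tree avoiding the target: along
a branch, each index of even position is read as the integer picked by the first player and each
index of odd position as the number of frame vectors to be annihilated. -/
theorem ReplierWins.exists_tree (hX : ¬ FiniteDimensional 𝕜 X) {x : ℕ → X} {f : ℕ → StrongDual 𝕜 X}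
    (hframe : IsSchauderFrame x f) {C : Set (ℕ → ℕ × DualSphere 𝕜 X)} (hC : ReplierWins x C) :
    ∃ τ : List ℕ → DualSphere 𝕜 X,
      (∀ s : List ℕ, Odd s.length → ∀ v,
        Tendsto (fun k => (τ (s ++ [k]) : StrongDual 𝕜 X) v) atTop (𝓝 0)) ∧
      ∀ n : ℕ → ℕ, (fun ℓ => (n (2 * ℓ), τ ((List.range (2 * ℓ + 2)).map n))) ∉ C := by
  have hnull : ∀ y : ℕ → DualSphere 𝕜 X,
      (∀ m, (y m : StrongDual 𝕜 X) ∈ (annihilator 𝕜 x m).toSubmodule) →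
      ∀ v, Tendsto (fun m => (y m : StrongDual 𝕜 X) v) atTop (𝓝 0) := fun y hy =>
    tendsto_apply_zero_of_annihilates hframe (fun n => (mem_sphere_zero_iff_norm.1 (y n).2).le)
      fun n => mem_annihilator.1 (hy n)
  induction hC with
  | empty =>
    choose w hw using fun m => (annihilator 𝕜 x m).exists_mem_sphere hX
    exact ⟨fun s => w (s.getLastD 0), fun s _ => by simpa using hnull w hw, fun n => id⟩
  | step C y hy _ ih =>
    choose T hT hTC using ih
    refine ⟨graft y T, fun s hs => ?_, fun n hn => ?_⟩
    · match s, hs with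
      | [a], _ => exact hnull (y a) (hy a)
      | a :: b :: s, hs =>
        refine fun v => (hT a b s (by simpa [Nat.odd_add_one] using hs) v).congr fun k => ?_
        rw [List.cons_append, List.cons_append, graft_cons_cons _ _ _ _ (by simp)]
    · refine hTC (n 0) (n 1) (fun j => n (j + 2)) ?_
      change cons _ _ ∈ C
      convert hn using 1
      funext ℓ
      cases ℓ with
      | zero => simp [cons, graft, List.range_succ]
      | succ ℓ =>
        have hl : (List.range (2 * (ℓ + 1) + 2)).map n =
            n 0 :: n 1 :: (List.range (2 * ℓ + 2)).map (fun j => n (j + 2)) := by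
          rw [show 2 * (ℓ + 1) + 2 = 2 * ℓ + 2 + 1 + 1 by ring, List.range_succ_eq_map,
            List.range_succ_eq_map]
          simp [Function.comp_def]
        rw [hl, graft_cons_cons _ _ _ _ (by simp)]
        rfl

/-- If the second player cannot win the simplified game for `closure A_ε`, the first player wins
the `(A, ε)`-game: every reply is first moved onto the sphere of the annihilator that the first
player asked for, and the first player keeps to residuals not won by the second player. -/
theorem exists_isWinning_of_not_replierWins (hX : ¬ FiniteDimensional 𝕜 X) {x : ℕ → X}
    {A : Set (ℕ → ℕ × DualSphere 𝕜 X)} {ε : ℝ} (hε : 0 < ε)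
    (hC : ¬ ReplierWins x (fattenClosure A ε)) :
    ∃ σ : Strategy 𝕜 X, σ.IsWinning A ε := by
  have hmove : ∀ C : Set (ℕ → ℕ × DualSphere 𝕜 X), ∃ k m, ¬ ReplierWins x C →
      ∀ y : DualSphere 𝕜 X, (y : StrongDual 𝕜 X) ∈ (annihilator 𝕜 x m).toSubmodule →
        ¬ ReplierWins x (residual C (k, y)) := by
    intro C
    by_contra! hcon
    choose hW y hy h using hcon
    exact hW 0 0 (.step C y hy h)
  choose k m hkm using hmove
  choose q hq hqd using fun m => (annihilator 𝕜 x m).exists_mem_sphere_norm_sub_le hX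
  let next : Set (ℕ → ℕ × DualSphere 𝕜 X) → DualSphere 𝕜 X → Set (ℕ → ℕ × DualSphere 𝕜 X) :=
    fun C y => residual C (k C, q (m C) y)
  let σ : Strategy 𝕜 X := fun l =>
    (k (l.foldl next (fattenClosure A ε)), annihilator 𝕜 x (m (l.foldl next (fattenClosure A ε))))
  refine ⟨σ, fun y hy => ?_⟩
  let C : ℕ → Set (ℕ → ℕ × DualSphere 𝕜 X) :=
    fun n => ((List.range n).map y).foldl next (fattenClosure A ε)
  have C_succ : ∀ n, C (n + 1) = residual (C n) (k (C n), q (m (C n)) (y n)) := fun n => by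
    simp [C, List.range_succ, next]
  have hnot : ∀ n, ¬ ReplierWins x (C n) := by
    intro n
    induction n with
    | zero => exact hC
    | succ n ih => rw [C_succ]; exact hkm _ ih _ (hq _ _)
  let a : ℕ → ℕ × DualSphere 𝕜 X := fun n => (k (C n), q (m (C n)) (y n))
  have hext : ∀ n, ∀ b ∈ C n, (fun i => if i < n then a i else b (i - n)) ∈ fattenClosure A ε := by
    intro n
    induction n with
    | zero =>
      intro b hb
      have hb' : b ∈ fattenClosure A ε := hb
      simpa using hb'
    | succ n ih =>
      intro b hb
      rw [C_succ] at hb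
      convert ih _ hb using 2 with i
      rcases lt_trichotomy i n with h | rfl | h
      · simp [h, h.trans (Nat.lt_succ_self n)]
      · simp [cons, a]
      · obtain ⟨j, rfl⟩ := Nat.exists_eq_add_of_lt h
        simp [cons, show ¬ n + j + 1 < n by omega, show n + j + 1 - n = j + 1 by omega,
          show n + j + 1 - (n + 1) = j by omega]
  have hne : ∀ n, (C n).Nonempty := fun n =>
    Set.nonempty_iff_ne_empty.2 fun h => hnot n (h ▸ .empty)
  choose b hb using hne
  have ha : a ∈ fattenClosure A ε := by
    refine isClosed_closure.mem_of_tendsto (b := atTop)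
      (f := fun n i => if i < n then a i else b n (i - n)) ?_
      (Eventually.of_forall fun n => hext n _ (hb n))
    refine tendsto_pi_nhds.2 fun i => tendsto_const_nhds.congr' ?_
    filter_upwards [eventually_gt_atTop i] with n hn using (if_pos hn).symm
  refine fattenClosure_mono (show ε + 3 * ε ≤ 5 * ε by linarith)
    (mem_fattenClosure_of_perturb ha (fun n => le_rfl) fun n => ?_)
  have h1 : Metric.infDist (y n : StrongDual 𝕜 X)
      ((annihilator 𝕜 x (m (C n))).toSubmodule : Set (StrongDual 𝕜 X)) <
        ε * (2⁻¹ : ℝ) ^ (n + 1) := hy n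
  have h2 := hqd (m (C n)) (y n)
  change ‖(q (m (C n)) (y n) : StrongDual 𝕜 X) - y n‖ < _
  linarith

/-- If every weak-star null tree has a branch in `closure A_ε`, then the first player wins the
`(A, ε)`-game. -/
theorem exists_isWinning_of_forall_tree (hX : ¬ FiniteDimensional 𝕜 X) {x : ℕ → X}
    {f : ℕ → StrongDual 𝕜 X} (hframe : IsSchauderFrame x f)
    {A : Set (ℕ → ℕ × DualSphere 𝕜 X)} {ε : ℝ} (hε : 0 < ε)
    (h : ∀ t : NormalizedEvenTree 𝕜 X, t.IsWeakStarNull →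
      ∃ (n : ℕ → ℕ) (hn : StrictMono n), t.branch n hn ∈ fattenClosure A ε) :
    ∃ σ : Strategy 𝕜 X, σ.IsWinning A ε := by
  refine exists_isWinning_of_not_replierWins hX (x := x) hε fun hW => ?_
  obtain ⟨τ, hτ, hτC⟩ := hW.exists_tree hX hframe
  obtain ⟨n, hn, hb⟩ := h (fun s => τ s.1) fun s hs ho => by
    refine tendsto_toWeakDual_zero_iff.2 fun v => (hτ s ho v).comp ?_
    refine tendsto_atTop.2 fun N => ?_
    obtain ⟨k, hNk, hk⟩ := exists_forall_mem_lt s N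
    filter_upwards [eventually_ge_atTop ⟨k, hk⟩] with j hj using hNk.trans hj
  exact hτC n hb

/-! ### From a winning strategy to the uniform condition -/

/-- The unit functionals that are `δ`-close to their `p`-th partial sum have a finite `3δ`-net,
because these partial sums lie in a compact subset of the span of `f 0, …, f (p - 1)`. -/
theorem exists_finite_net (x : ℕ → X) (f : ℕ → StrongDual 𝕜 X) (p : ℕ) {δ : ℝ} (hδ : 0 < δ) :
    ∃ N : Finset (DualSphere 𝕜 X), ∀ y : DualSphere 𝕜 X,
      ‖(y : StrongDual 𝕜 X).comp (frameTail x f p)‖ ≤ δ →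
        ∃ w ∈ N, ‖(w : StrongDual 𝕜 X) - y‖ ≤ 3 * δ := by
  classical
  let S : StrongDual 𝕜 X → StrongDual 𝕜 X := fun φ => ∑ j ∈ Finset.range p, φ (x j) • f j
  have hS : ∀ φ, φ - S φ = φ.comp (frameTail x f p) := fun φ => (comp_frameTail x f p φ).symm
  let D : Set (DualSphere 𝕜 X) := {y | ‖(y : StrongDual 𝕜 X).comp (frameTail x f p)‖ ≤ δ}
  have hcomp : IsCompact ((fun c : ℕ → 𝕜 => ∑ j ∈ Finset.range p, c j • f j) ''
      Set.univ.pi fun j => Metric.closedBall 0 ‖x j‖) := by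
    refine (isCompact_univ_pi fun j => isCompact_closedBall _ _).image ?_
    exact continuous_finsetSum _ fun j _ => (continuous_apply j).smul continuous_const
  have htb : TotallyBounded ((fun y : DualSphere 𝕜 X => S y) '' D) := by
    refine hcomp.totallyBounded.subset ?_
    rintro _ ⟨y, -, rfl⟩
    refine ⟨fun j => (y : StrongDual 𝕜 X) (x j), fun j _ => ?_, rfl⟩
    rw [mem_closedBall_zero_iff]
    simpa using (y : StrongDual 𝕜 X).le_of_opNorm_le (mem_sphere_zero_iff_norm.1 y.2).le (x j)
  obtain ⟨T, hTD, hTf, hcov⟩ := Set.exists_subset_image_finite_and.1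
    (Metric.finite_approx_of_totallyBounded htb δ hδ)
  refine ⟨hTf.toFinset, fun y hy => ?_⟩
  obtain ⟨_, ⟨w, hw, rfl⟩, hyw⟩ := Set.mem_iUnion₂.1 (hcov ⟨y, hy, rfl⟩)
  refine ⟨w, by simpa using hw, ?_⟩
  have h1 := hTD hw
  change ‖_‖ ≤ δ at h1
  rw [← hS] at h1 hy
  rw [mem_ball_iff_norm'] at hyw
  have h2 : (w : StrongDual 𝕜 X) - y = (w - S w) + (S w - S y) - (y - S y) := by abel
  rw [h2]
  refine (norm_sub_le _ _).trans ((add_le_add_left (norm_add_le _ _) _).trans ?_)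
  change ‖S w - S y‖ < δ at hyw
  linarith

/-- Given finite sets `N p j` of possible letters and an eventually true condition `R L n`, one can
choose an increasing sequence `p` and finite sets `H n` of words such that `H (n + 1)` contains all
extensions of words in `H n` by letters in `N (p (n + 1)) j`, `j ≤ n`, while `R L n` holds from
`p (n + 1)` on for all words `L` in `H n`. -/
theorem exists_finite_histories {β : Type*} (N : ℕ → ℕ → Finset β) {R : List β → ℕ → ℕ → Prop}
    (hR : ∀ L n, ∀ᶠ q in atTop, R L n q) :
    ∃ (p : ℕ → ℕ) (H : ℕ → Finset (List β)), StrictMono p ∧ [] ∈ H 0 ∧ Monotone H ∧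
      (∀ n, ∀ L ∈ H n, ∀ j ≤ n, ∀ w ∈ N (p (n + 1)) j, L ++ [w] ∈ H (n + 1)) ∧
      ∀ n, ∀ L ∈ H n, ∀ q ≥ p (n + 1), R L n q := by
  classical
  have hstep : ∀ (H : Finset (List β)) (p n : ℕ), ∃ p', p < p' ∧ ∀ L ∈ H, ∀ q ≥ p', R L n q := by
    intro H p n
    have h1 : ∀ᶠ q in atTop, ∀ L ∈ H, R L n q := (Finset.eventually_all H).2 fun L _ => hR L n
    obtain ⟨q₀, hq₀⟩ := eventually_atTop.1 h1
    exact ⟨max q₀ (p + 1), by omega, fun L hL q hq => hq₀ q (by omega) L hL⟩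
  choose g hg hgR using hstep
  let st : ℕ → ℕ × Finset (List β) := fun n => n.rec (0, {[]}) fun n s =>
    (g s.2 s.1 n, s.2 ∪ s.2.biUnion fun L => (Finset.range (n + 1)).biUnion fun j =>
      (N (g s.2 s.1 n) j).image fun w => L ++ [w])
  refine ⟨fun n => (st n).1, fun n => (st n).2, strictMono_nat_of_lt_succ fun n => hg _ _ _,
    by simp [st], monotone_nat_of_le_succ fun n => Finset.subset_union_left,
    fun n L hL j hj w hw => ?_, fun n L hL q hq => hgR _ _ _ L hL q hq⟩
  refine Finset.mem_union_right _ (Finset.mem_biUnion.2 ⟨L, hL, Finset.mem_biUnion.2 ⟨j, ?_, ?_⟩⟩)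
  · simp; omega
  · exact Finset.mem_image_of_mem _ hw

theorem norm_lt_of_iSup_enorm_lt_ofReal {ι E : Type*} [SeminormedAddCommGroup E]
    {P : ι → ι → Prop} {g : ι → ι → E} {δ : ℝ} (hδ : 0 < δ)
    (h : (⨆ (m : ι) (n : ι) (_ : P m n), ‖g m n‖ₑ) < ENNReal.ofReal δ) {m n : ι} (hmn : P m n) :
    ‖g m n‖ < δ := by
  have h1 : ‖g m n‖ₑ ≤ ⨆ (m : ι) (n : ι) (_ : P m n), ‖g m n‖ₑ :=
    le_iSup₂_of_le m n (le_iSup (fun _ : P m n => ‖g m n‖ₑ) hmn)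
  rw [← ENNReal.ofReal_lt_ofReal_iff hδ, ofReal_norm]
  exact h1.trans_lt h

theorem IsShrinking.norm_comp_frameTail_le {x : ℕ → X} {f : ℕ → StrongDual 𝕜 X}
    (h : IsShrinking x f) {φ : StrongDual 𝕜 X} {p : ℕ} {δ : ℝ}
    (hs : ∀ n ≥ p, ‖∑ j ∈ Finset.Icc p n, φ (x j) • f j‖ < δ) :
    ‖φ.comp (frameTail x f p)‖ ≤ δ := by
  have ht : Tendsto (fun n => ‖φ.comp (frameTail x f p) - φ.comp (frameTail x f (n + 1))‖) atTop
      (𝓝 ‖φ.comp (frameTail x f p)‖) := by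
    have := ((tendsto_zero_iff_norm_tendsto_zero.2 (h φ)).comp (tendsto_add_atTop_nat 1)).const_sub
      (φ.comp (frameTail x f p))
    rw [sub_zero] at this
    exact this.norm
  refine le_of_tendsto ht ?_
  filter_upwards [eventually_ge_atTop p] with n hn
  rw [← sum_Icc_eq_sub_comp_frameTail x f hn]
  exact (hs n hn).le

/-- A winning strategy is made uniform by feeding it only letters from finite nets: the replies
`y i` satisfying the two smallness conditions are close to net points `w i`, the histories
`w 0, …, w (i - 1)` that can occur before stage `n` form a finite set, and so `K n` and
`p (n + 1)` can be chosen to cope with all answers of the strategy to them. -/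
theorem Strategy.IsWinning.exists_uniform {x : ℕ → X} {f : ℕ → StrongDual 𝕜 X}
    (hframe : IsSchauderFrame x f) (hshrink : IsShrinking x f)
    {A : Set (ℕ → ℕ × DualSphere 𝕜 X)} {ε : ℝ} (hε : 0 < ε) {σ : Strategy 𝕜 X}
    (hσ : σ.IsWinning A ε) :
    ∃ (K : ℕ → ℕ) (δ : ℕ → ℝ) (p : ℕ → ℕ),
      StrictMono K ∧
      (∀ i, 0 < δ i ∧ δ i < 1) ∧ Antitone δ ∧ Tendsto δ atTop (𝓝 0) ∧
      StrictMono p ∧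
      ∀ (y : ℕ → DualSphere 𝕜 X) (r : ℕ → ℕ), StrictMono r →
        (∀ i,
          (⨆ (m : ℕ) (n : ℕ) (_ : m ≤ n ∧ n ≤ p (r i + 1)),
            ‖∑ j ∈ Finset.Icc m n, (y i : StrongDual 𝕜 X) (x j) • f j‖ₑ)
              < ENNReal.ofReal (δ i) ∧
          (⨆ (m : ℕ) (n : ℕ) (_ : p (r (i + 1)) ≤ m ∧ m ≤ n),
            ‖∑ j ∈ Finset.Icc m n, (y i : StrongDual 𝕜 X) (x j) • f j‖ₑ)
              < ENNReal.ofReal (δ i)) →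
        (fun i => (K (r i), y i)) ∈ fattenClosure A (6 * ε) := by
  classical
  -- With this `δ`, both `3 * δ i` and `4 * δ i + ε * 2⁻¹ ^ (i + 2)` stay below
  -- `ε * 2⁻¹ ^ (i + 1)`.
  let δ : ℕ → ℝ := fun i => min (1 / 2) ε * (2⁻¹ : ℝ) ^ (i + 5)
  have hmin : 0 < min (1 / 2) ε := lt_min (by norm_num) hε
  have hδ0 : ∀ i, 0 < δ i := fun i => by positivity
  have hpow : ∀ i : ℕ, (2⁻¹ : ℝ) ^ i ≤ 1 := fun i => pow_le_one₀ (by norm_num) (by norm_num)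
  have hδ1 : ∀ i, δ i < 1 := fun i => by
    calc δ i ≤ min (1 / 2) ε * 1 := mul_le_mul_of_nonneg_left (hpow _) hmin.le
      _ < 1 := by linarith [min_le_left (1 / 2) ε]
  have hδε : ∀ i, 16 * δ i ≤ ε * (2⁻¹ : ℝ) ^ (i + 1) := fun i => by
    have : 16 * δ i = min (1 / 2) ε * (2⁻¹ : ℝ) ^ (i + 1) := by
      simp only [δ, pow_succ]; ring
    rw [this]
    gcongr
    exact min_le_right _ _
  have hanti : Antitone δ := fun i j hij =>
    mul_le_mul_of_nonneg_left
      (pow_le_pow_of_le_one (by norm_num) (by norm_num) (by omega)) hmin.le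
  have hlim : Tendsto δ atTop (𝓝 0) := by
    have := ((tendsto_pow_atTop_nhds_zero_of_lt_one (r := (2⁻¹ : ℝ)) (by norm_num)
      (by norm_num)).comp (tendsto_add_atTop_nat 5)).const_mul (min (1 / 2) ε)
    rwa [mul_zero] at this
  choose N hN using fun p j => exists_finite_net x f p (hδ0 j)
  obtain ⟨p, H, hp, hH0, hH, hHN, hHR⟩ := exists_finite_histories N
    (R := fun L n q => ∀ φ : StrongDual 𝕜 X, ‖φ‖ ≤ 1 →
      Metric.infDist (φ.comp (frameTail x f q)) ((σ L).2.toSubmodule : Set (StrongDual 𝕜 X))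
        < ε * (2⁻¹ : ℝ) ^ (n + 2))
    fun L n => eventually_atTop.2
      ((σ L).2.exists_infDist_comp_frameTail_lt hframe (by positivity))
  let K : ℕ → ℕ := fun n => n + (H n).sup fun L => (σ L).1
  refine ⟨K, δ, p, fun n n' hn => ?_, fun i => ⟨hδ0 i, hδ1 i⟩, hanti, hlim, hp,
    fun y r hr hyr => ?_⟩
  · exact add_lt_add_of_lt_of_le hn (Finset.sup_mono (hH hn.le))
  have hclose : ∀ i, ‖(y i : StrongDual 𝕜 X).comp (frameTail x f (p (r (i + 1))))‖ ≤ δ i :=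
    fun i => hshrink.norm_comp_frameTail_le fun n hn =>
      norm_lt_of_iSup_enorm_lt_ofReal (hδ0 i) (hyr i).2 ⟨le_rfl, hn⟩
  choose w hwN hwy using fun i => hN (p (r (i + 1))) i (y i) (hclose i)
  have hhist : ∀ i, (List.range i).map w ∈ H (r i) := by
    intro i
    induction i with
    | zero => exact hH (Nat.zero_le _) hH0
    | succ i ih =>
      rw [List.range_succ, List.map_append]
      have hlt : r i < r (i + 1) := hr (Nat.lt_succ_self i)
      obtain ⟨n, hn⟩ : ∃ n, r (i + 1) = n + 1 := ⟨r (i + 1) - 1, by omega⟩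
      have hi : i ≤ r i := hr.id_le i
      have := hwN i
      rw [hn] at this ⊢
      exact hHN n _ (hH (by omega) ih) i (by omega) _ this
  have hlegal : ∀ i, Metric.infDist (w i : StrongDual 𝕜 X)
      ((σ.move w i).2.toSubmodule : Set (StrongDual 𝕜 X)) < ε * (2⁻¹ : ℝ) ^ (i + 1) := by
    intro i
    set L := (List.range i).map w with hL
    change Metric.infDist _ ((σ L).2.toSubmodule : Set (StrongDual 𝕜 X)) < _
    have h1 : Metric.infDist ((y i : StrongDual 𝕜 X).comp (frameTail x f (p (r i + 1) + 1)))
        ((σ L).2.toSubmodule : Set (StrongDual 𝕜 X)) < ε * (2⁻¹ : ℝ) ^ (i + 2) := by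
      refine (hHR (r i) L (hhist i) _ (Nat.le_succ _) _
        (mem_sphere_zero_iff_norm.1 (y i).2).le).trans_le ?_
      have hi : i ≤ r i := hr.id_le i
      exact mul_le_mul_of_nonneg_left
        (pow_le_pow_of_le_one (by norm_num) (by norm_num) (by omega)) hε.le
    have h2 : ‖∑ j ∈ Finset.Icc 0 (p (r i + 1)), (y i : StrongDual 𝕜 X) (x j) • f j‖ < δ i :=
      norm_lt_of_iSup_enorm_lt_ofReal (hδ0 i) (hyr i).1 ⟨Nat.zero_le _, le_rfl⟩
    have h3 : (w i : StrongDual 𝕜 X) - (y i : StrongDual 𝕜 X).comp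
        (frameTail x f (p (r i + 1) + 1)) = (w i - y i) +
          ∑ j ∈ Finset.Icc 0 (p (r i + 1)), (y i : StrongDual 𝕜 X) (x j) • f j := by
      rw [comp_frameTail, ← Finset.Ico_add_one_right_eq_Icc, ← Nat.Ico_zero_eq_range]
      abel
    have h4 := norm_add_le ((w i : StrongDual 𝕜 X) - y i)
      (∑ j ∈ Finset.Icc 0 (p (r i + 1)), (y i : StrongDual 𝕜 X) (x j) • f j)
    rw [← h3, ← dist_eq_norm] at h4
    have h5 := Metric.infDist_le_infDist_add_dist
      (s := ((σ L).2.toSubmodule : Set (StrongDual 𝕜 X))) (x := (w i : StrongDual 𝕜 X))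
      (y := (y i : StrongDual 𝕜 X).comp (frameTail x f (p (r i + 1) + 1)))
    have h6 : ε * (2⁻¹ : ℝ) ^ (i + 2) = ε * (2⁻¹ : ℝ) ^ (i + 1) / 2 := by rw [pow_succ]; ring
    linarith [hwy i, hδε i, hδ0 i]
  rw [show 6 * ε = 5 * ε + ε by ring]
  refine mem_fattenClosure_of_perturb (hσ w hlegal) (fun i => ?_) fun i => ?_
  · have h1 : (σ ((List.range i).map w)).1 ≤ (H (r i)).sup fun L => (σ L).1 :=
      Finset.le_sup (f := fun L => (σ L).1) (hhist i)
    exact h1.trans (Nat.le_add_left _ _)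
  · exact (hwy i).trans_lt (by linarith [hδε i, hδ0 i])

end FrameGame

/-! ### The equivalence -/

theorem mainTheorem9 {𝕜 : Type*} [RCLike 𝕜] {X : Type*} [NormedAddCommGroup X]
    [NormedSpace 𝕜 X] [CompleteSpace X] (hX : ¬ FiniteDimensional 𝕜 X)
    (x : ℕ → X) (f : ℕ → StrongDual 𝕜 X)
    (hframe : FrameGame.IsSchauderFrame x f) (hshrink : FrameGame.IsShrinking x f)
    (A : Set (ℕ → ℕ × FrameGame.DualSphere 𝕜 X)) :
    List.TFAE
      [∀ ε : ℝ, 0 < ε →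
        ∃ (K : ℕ → ℕ) (δ : ℕ → ℝ) (p : ℕ → ℕ),
          StrictMono K ∧
          (∀ i, 0 < δ i ∧ δ i < 1) ∧ Antitone δ ∧ Tendsto δ atTop (𝓝 0) ∧
          StrictMono p ∧
          ∀ (y : ℕ → FrameGame.DualSphere 𝕜 X) (r : ℕ → ℕ), StrictMono r →
            (∀ i,
              (⨆ (m : ℕ) (n : ℕ) (_ : m ≤ n ∧ n ≤ p (r i + 1)),
                ‖∑ j ∈ Finset.Icc m n, (y i : StrongDual 𝕜 X) (x j) • f j‖ₑ)
                  < ENNReal.ofReal (δ i) ∧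
              (⨆ (m : ℕ) (n : ℕ) (_ : p (r (i + 1)) ≤ m ∧ m ≤ n),
                ‖∑ j ∈ Finset.Icc m n, (y i : StrongDual 𝕜 X) (x j) • f j‖ₑ)
                  < ENNReal.ofReal (δ i)) →
            (fun i => (K (r i), y i)) ∈ FrameGame.fattenClosure A ε,
       ∀ ε : ℝ, 0 < ε → ∃ σ : FrameGame.Strategy 𝕜 X, σ.IsWinning A ε,
       ∀ ε : ℝ, 0 < ε → ∀ t : FrameGame.NormalizedEvenTree 𝕜 X, t.IsWeakStarNull →
        ∃ (n : ℕ → ℕ) (hn : StrictMono n), t.branch n hn ∈ FrameGame.fattenClosure A ε] := by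
  tfae_have 1 → 3 := fun h ε hε t ht => by
    obtain ⟨K, δ, p, -, hδ, -, -, hp, hmem⟩ := h ε hε
    exact ht.exists_branch_mem hshrink (fun i => (hδ i).1) hp hmem
  tfae_have 3 → 2 := fun h ε hε =>
    FrameGame.exists_isWinning_of_forall_tree hX hframe hε (h ε hε)
  tfae_have 2 → 1 := fun h ε hε => by
    obtain ⟨σ, hσ⟩ := h (ε / 6) (by positivity)
    have := hσ.exists_uniform hframe hshrink (by positivity)
    rwa [mul_div_cancel₀ ε (by norm_num : (6 : ℝ) ≠ 0)] at this
  tfae_finish
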